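/- Let $C$ be a closed convex subset of a real normed space $X$ and let $T:C\to C$ be nonexpansive, i.e. $\|Tx-Ty\|\le\|x-y\|$ for all $x,y\in C$. Let $(\alpha_n)_{n\ge 1}$ be a sequence in $[0,1]$, let $(e_n)_{n\ge 1}$ be a sequence in $X$, and let $(\epsilon_n)_{n\ge 1}$ be real numbers with $\epsilon_n\ge\|e_n\|$ for all $n\ge 1$. Let $(x_n)_{n\ge 0}$ be a sequence satisfying $$x_{n+1}=(1-\alpha_{n+1})\,x_n+\alpha_{n+1}\,(Tx_n+e_{n+1})\qquad\text{for all } n\ge 0,$$ and assume that there is $\kappa\in[0,\infty)$ such that $x_n\in C$ and $\|Tx_n-x_0\|\le\kappa$ for all $n\ge 0$. Put $\tau_n=\sum_{k=1}^n\alpha_k(1-\alpha_k)$, $\sigma(0)=1$, and $\sigma(y)=\min\{1,1/\sqrt{\pi y}\}$ for $y>0$. Then, for all $n\ge 0$, $$\|x_n-Tx_n\|\le\kappa\,\sigma(\tau_n)+\sum_{i=1}^{n}2\,\alpha_i\,\epsilon_i\,\sigma(\tau_n-\tau_i)+2\,\epsilon_{n+1}.$$ In particular, if $\tau_n\to\infty$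 and $\epsilon_n\to 0$ as $n\to\infty$, and $\sum_{k\ge 1}\alpha_k\epsilon_k<\infty$, then $\|x_n-Tx_n\|\to 0$. -/

import Mathlib

open Filter Topology

namespace InexactKM

/-- The function `σ(y) = min {1, 1/√(π y)}` for `y ≥ 0`, where `1/√0 = +∞`, so that `σ(0) = 1`
(division by zero in Lean gives `0`, hence the case distinction). -/
noncomputable def sigma (y : ℝ) : ℝ :=
  if 0 < y then min 1 (1 / Real.sqrt (Real.pi * y)) else 1

/-- `τ_n = ∑_{k=1}^n α_k (1 - α_k)`. -/
def tau (α : ℕ → ℝ) (n : ℕ) : ℝ :=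
  ∑ k ∈ Finset.Icc 1 n, α k * (1 - α k)

/-- The sequence `x` is generated by the inexact Krasnosel'skii-Mann iteration
`x_{n+1} = (1 - α_{n+1}) x_n + α_{n+1} (T x_n + e_{n+1})`. -/
def IsIteration {X : Type*} [NormedAddCommGroup X] [NormedSpace ℝ X]
    (T : X → X) (α : ℕ → ℝ) (e : ℕ → X) (x : ℕ → X) : Prop :=
  ∀ n : ℕ, x (n + 1) = (1 - α (n + 1)) • x n + α (n + 1) • (T (x n) + e (n + 1))

end InexactKM

/-!
The distances `‖x m - T (x n)‖` and `‖x m - x n‖` with `m ≤ n` satisfy a recursive system of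
inequalities: expanding `x n` gives
`‖x m - x n‖ ≤ (1 - α n) ‖x m - x (n-1)‖ + α n (‖x m - T (x (n-1))‖ + ε n)`, and expanding `x m` and
using that `T` is nonexpansive gives
`‖x m - T (x n)‖ ≤ (1 - α m) ‖x (m-1) - T (x n)‖ + α m (‖x (m-1) - x n‖ + ε m)`.
Reading `α k` as the success probability of a coin tossed at level `k`, once by a "fox" at `m` and
once by a "hare" at `n`, the solution of this system is expressed through a symmetric lazy random
walk on `ℕ` that is absorbed at `0`; its steps are the differences of the two coins at the same
level, so that it moves by `±1` with probability `α k (1 - α k)` each. The walk collects a reward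
`2 α k ε k` at each level that it survives and `κ` at the end. Here `payoff` is the expected total
reward, `coinAvg` is the expectation over the coins that the hare tosses ahead of the fox, and
`norm_sub_le_coinAvg` is the resulting bound, which for `m = n` is
`‖x n - T (x n)‖ ≤ payoff n 1`.

By the reflection principle, the survival probability has a Fourier representation (`survival`,
`payoff_eq`): started at `1` it is
`(1/π) ∫_0^π ∏ (1 - 2 α k (1 - α k) (1 - cos θ)) (1 + cos θ) dθ`. Estimating the product by an
exponential and substituting `s = sin (θ/2)` bounds this by a Gaussian integral, which gives
`1/√(π τ)` (`survival_one_le_sigma`). The convergence statement follows from the bound by dominated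
convergence for series.
-/

namespace InexactKM

open intervalIntegral

/-! ### Comparison with an absorbed random walk -/

/-- The expected reward of the absorbed random walk that starts at `t : ℕ` and runs through the
levels `n, n - 1, …, 1`. At level `k` a walk at `t > 0` earns `2 α k ε k` and moves by `±1` with
probability `α k (1 - α k)` each; at the end a surviving walk earns `κ`. At `0` it is absorbed. -/
noncomputable def payoff (α ε : ℕ → ℝ) (κ : ℝ) : ℕ → ℕ → ℝ
  | _, 0 => 0
  | 0, _ + 1 => κ
  | n + 1, t + 1 =>
      (1 - 2 * α (n + 1) * (1 - α (n + 1))) * payoff α ε κ n (t + 1)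
        + α (n + 1) * (1 - α (n + 1)) * (payoff α ε κ n (t + 2) + payoff α ε κ n t)
        + 2 * α (n + 1) * ε (n + 1)

/-- The expectation of `f (t + ξ)` where `ξ` is the number of successes among independent coins
at the levels `m + 1, …, m + d`, the coin at level `k` having success probability `α k`. -/
def coinAvg (α : ℕ → ℝ) (m : ℕ) : ℕ → (ℕ → ℝ) → ℕ → ℝ
  | 0, f, t => f t
  | d + 1, f, t =>
      (1 - α (m + d + 1)) * coinAvg α m d f t + α (m + d + 1) * coinAvg α m d f (t + 1)

/-- The coin of the lowest level may be averaged first. -/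
lemma coinAvg_succ_left (α : ℕ → ℝ) (m d : ℕ) (f : ℕ → ℝ) (t : ℕ) :
    coinAvg α m (d + 1) f t =
      coinAvg α (m + 1) d (fun s => (1 - α (m + 1)) * f s + α (m + 1) * f (s + 1)) t := by
  induction d generalizing t with
  | zero => rfl
  | succ d ih =>
    rw [coinAvg, ih, ih, coinAvg, show m + 1 + d + 1 = m + (d + 1) + 1 by ring]

/-- A relation that holds away from the absorbing point `0` is preserved by averaging, because
coins only increase the argument. -/
lemma coinAvg_add_one_eq (α : ℕ → ℝ) (m d : ℕ) (f g : ℕ → ℝ) (a c : ℝ)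
    (h : ∀ t, f (t + 1) = (1 - a) * g (t + 1) + a * g t + c) (t : ℕ) :
    coinAvg α m d f (t + 1) =
      (1 - a) * coinAvg α m d g (t + 1) + a * coinAvg α m d g t + c := by
  induction d generalizing t with
  | zero => exact h t
  | succ d ih => simp only [coinAvg, ih]; ring

/-- Conditioning on the fox's coin at level `m + 1`: the recursive inequality for `x (m + 1)` holds
with equality for the averaged payoffs, the second `α ε` being the hare's error at that level. -/
lemma coinAvg_payoff_succ (α ε : ℕ → ℝ) (κ : ℝ) (m d : ℕ) :
    coinAvg α (m + 1) d (payoff α ε κ (m + 1)) 1 =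
      (1 - α (m + 1)) * coinAvg α m (d + 1) (payoff α ε κ m) 1
        + α (m + 1) * coinAvg α m (d + 1) (payoff α ε κ m) 0
        + 2 * α (m + 1) * ε (m + 1) := by
  rw [coinAvg_succ_left, coinAvg_succ_left]
  refine coinAvg_add_one_eq α (m + 1) d _ _ _ _ (fun t => ?_) 0
  simp only [payoff]
  ring

lemma coinAvg_payoff_zero_succ (α ε : ℕ → ℝ) (κ : ℝ) (d t : ℕ) :
    coinAvg α 0 d (payoff α ε κ 0) (t + 1) = κ := by
  induction d generalizing t with
  | zero => simp [coinAvg, payoff]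
  | succ d ih => simp only [coinAvg, ih]; ring

lemma coinAvg_zero_zero (α ε : ℕ → ℝ) (κ : ℝ) (m : ℕ) :
    coinAvg α m 0 (payoff α ε κ m) 0 = 0 := by
  cases m <;> simp [coinAvg, payoff]

section Iteration

variable {X : Type*} [NormedAddCommGroup X] [NormedSpace ℝ X]

/-- A step of the iteration replaces the distance to `z` by at most an average of the old distance
to `z` and the distance of `T (x n)` to `z`, up to the error. -/
lemma IsIteration.norm_succ_sub_le {T : X → X} {α : ℕ → ℝ} {e x : ℕ → X} {ε : ℕ → ℝ}
    (hx : IsIteration T α e x) (hα : ∀ n : ℕ, 1 ≤ n → α n ∈ Set.Icc (0 : ℝ) 1)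
    (hε : ∀ n : ℕ, 1 ≤ n → ‖e n‖ ≤ ε n) (n : ℕ) (z : X) :
    ‖x (n + 1) - z‖ ≤
      (1 - α (n + 1)) * ‖x n - z‖ + α (n + 1) * (‖T (x n) - z‖ + ε (n + 1)) := by
  obtain ⟨h0, h1⟩ := hα (n + 1) (by omega)
  have h : x (n + 1) - z =
      (1 - α (n + 1)) • (x n - z) + α (n + 1) • ((T (x n) - z) + e (n + 1)) := by
    rw [hx n]; module
  rw [h]
  refine (norm_add_le _ _).trans ?_
  rw [norm_smul, norm_smul, Real.norm_of_nonneg h0, Real.norm_of_nonneg (sub_nonneg.2 h1)]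
  gcongr
  exact (norm_add_le _ _).trans (by gcongr; exact hε _ (by omega))

/-- Comparison of the iteration with the random walk. The last sum accounts for the errors at the
levels that only the hare has passed. -/
lemma norm_sub_le_coinAvg {C : Set X} {T : X → X} (hT : LipschitzOnWith 1 T C)
    {α : ℕ → ℝ} {e x : ℕ → X} {ε : ℕ → ℝ}
    (hx : IsIteration T α e x) (hα : ∀ n : ℕ, 1 ≤ n → α n ∈ Set.Icc (0 : ℝ) 1)
    (hε : ∀ n : ℕ, 1 ≤ n → ‖e n‖ ≤ ε n) {κ : ℝ}
    (hxC : ∀ n : ℕ, x n ∈ C) (hTx : ∀ n : ℕ, ‖T (x n) - x 0‖ ≤ κ) (m : ℕ) :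
    (∀ d, ‖x m - T (x (m + d))‖ ≤ coinAvg α m d (payoff α ε κ m) 1
        + ∑ k ∈ Finset.range d, α (m + k + 1) * ε (m + k + 1)) ∧
    (∀ d, ‖x m - x (m + d)‖ ≤ coinAvg α m d (payoff α ε κ m) 0
        + ∑ k ∈ Finset.range d, α (m + k + 1) * ε (m + k + 1)) := by
  -- The bound on the second family follows at each `m` from the first by induction on `d`.
  have hare : ∀ m, (∀ d, ‖x m - T (x (m + d))‖ ≤ coinAvg α m d (payoff α ε κ m) 1
        + ∑ k ∈ Finset.range d, α (m + k + 1) * ε (m + k + 1)) →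
      (∀ d, ‖x m - x (m + d)‖ ≤ coinAvg α m d (payoff α ε κ m) 0
        + ∑ k ∈ Finset.range d, α (m + k + 1) * ε (m + k + 1)) := by
    intro m hB d
    induction d with
    | zero => simp [coinAvg_zero_zero]
    | succ d ih =>
      obtain ⟨h0, h1⟩ := hα (m + d + 1) (by omega)
      have h := hx.norm_succ_sub_le hα hε (m + d) (x m)
      rw [norm_sub_rev (x m), ← add_assoc, coinAvg, Finset.sum_range_succ]
      have hB' := hB d
      rw [norm_sub_rev] at hB' ih
      have h2 := mul_le_mul_of_nonneg_left ih (sub_nonneg.2 h1)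
      have h3 := mul_le_mul_of_nonneg_left hB' h0
      rw [mul_add] at h2 h3 h
      simp only [zero_add]
      linarith
  induction m with
  | zero =>
    have h : ∀ d, ‖x 0 - T (x (0 + d))‖ ≤ coinAvg α 0 d (payoff α ε κ 0) 1
        + ∑ k ∈ Finset.range d, α (0 + k + 1) * ε (0 + k + 1) := by
      intro d
      rw [coinAvg_payoff_zero_succ α ε κ d 0, norm_sub_rev]
      refine (hTx _).trans (le_add_of_nonneg_right (Finset.sum_nonneg fun k _ => ?_))
      exact mul_nonneg (hα _ (by omega)).1 ((norm_nonneg _).trans (hε _ (by omega)))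
    exact ⟨h, hare 0 h⟩
  | succ m ih =>
    obtain ⟨hB, hA⟩ := ih
    have h : ∀ d, ‖x (m + 1) - T (x (m + 1 + d))‖ ≤
        coinAvg α (m + 1) d (payoff α ε κ (m + 1)) 1
        + ∑ k ∈ Finset.range d, α (m + 1 + k + 1) * ε (m + 1 + k + 1) := by
      intro d
      obtain ⟨h0, h1⟩ := hα (m + 1) (by omega)
      have e1 : m + 1 + d = m + (d + 1) := by ring
      have hstep := hx.norm_succ_sub_le hα hε m (T (x (m + 1 + d)))
      have hTT : ‖T (x m) - T (x (m + 1 + d))‖ ≤ ‖x m - x (m + 1 + d)‖ := by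
        simpa using hT.norm_sub_le (hxC m) (hxC (m + 1 + d))
      have hB' := hB (d + 1)
      have hA' := hTT.trans (e1 ▸ hA (d + 1))
      rw [← e1] at hB'
      rw [Finset.sum_range_succ'] at hB' hA'
      have h2 := mul_le_mul_of_nonneg_left hB' (sub_nonneg.2 h1)
      have h3 := mul_le_mul_of_nonneg_left hA' h0
      rw [coinAvg_payoff_succ]
      have e2 : ∀ k, m + 1 + k + 1 = m + (k + 1) + 1 := fun k => by ring
      simp only [e2, add_zero] at h2 h3 ⊢
      rw [mul_add] at hstep
      nlinarith
    exact ⟨h, hare _ h⟩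

end Iteration

/-! ### Fourier representation of the survival probability -/

/-- The real part of `∑_{-t < r ≤ t} e^{irθ}`. By the reflection principle, a symmetric walk started
at `t` avoids `0` with the same probability with which the displacement of the free walk lies in
`(-t, t]`, and this is the Fourier transform of that interval. -/
noncomputable def harmonic (t : ℕ) (θ : ℝ) : ℝ :=
  ∑ r ∈ Finset.range t, (Real.cos (r * θ) + Real.cos ((r + 1 : ℕ) * θ))

@[fun_prop]
lemma continuous_harmonic (t : ℕ) : Continuous (harmonic t) := by
  unfold harmonic; fun_prop

/-- `harmonic` is an eigenfunction of the free walk with the Dirichlet condition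
`harmonic 0 = 0`. -/
lemma harmonic_add_two (t : ℕ) (θ : ℝ) :
    harmonic (t + 2) θ + harmonic t θ = 2 * Real.cos θ * harmonic (t + 1) θ := by
  induction t with
  | zero =>
    have h : Real.cos (2 * θ) = 2 * Real.cos θ ^ 2 - 1 := Real.cos_two_mul θ
    simp [harmonic, Finset.sum_range_succ, one_add_one_eq_two, h]
    ring
  | succ t ih =>
    have key : ∀ s : ℝ, Real.cos ((s + 2) * θ) + Real.cos (s * θ)
        = 2 * Real.cos θ * Real.cos ((s + 1) * θ) := by
      intro s
      rw [show (s + 2) * θ = (s + 1) * θ + θ by ring, show s * θ = (s + 1) * θ - θ by ring,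
        Real.cos_add, Real.cos_sub]
      ring
    have k1 := key t
    have k2 := key (t + 1)
    have hs : ∀ n, harmonic (n + 1) θ =
        harmonic n θ + (Real.cos (n * θ) + Real.cos ((n + 1 : ℕ) * θ)) :=
      fun n => Finset.sum_range_succ _ _
    have s0 := hs t
    have s1 := hs (t + 1)
    have s2 := hs (t + 2)
    push_cast at s0 s1 s2
    rw [show (t : ℝ) + 1 + 2 = t + 2 + 1 by ring, show (t : ℝ) + 1 + 1 = t + 2 by ring] at k2
    rw [show (t : ℝ) + 1 + 1 = t + 2 by ring] at s1
    linear_combination s2 + s0 - 2 * Real.cos θ * s1 + ih + k1 + k2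

lemma integral_cos_succ_mul (r : ℕ) :
    ∫ θ in (0 : ℝ)..Real.pi, Real.cos ((r + 1 : ℕ) * θ) = 0 := by
  rw [intervalIntegral.integral_comp_mul_left (fun y => Real.cos y) (by positivity)]
  simp [Real.sin_nat_mul_pi, -Nat.cast_add]

lemma integral_harmonic_succ (t : ℕ) :
    ∫ θ in (0 : ℝ)..Real.pi, harmonic (t + 1) θ = Real.pi := by
  have hint : ∀ r : ℕ, IntervalIntegrable (fun θ : ℝ => Real.cos (r * θ))
      MeasureTheory.volume 0 Real.pi := fun r => by
    apply Continuous.intervalIntegrable; fun_prop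
  unfold harmonic
  rw [integral_finsetSum fun r _ => (hint r).add (hint (r + 1))]
  simp_rw [integral_add (hint _) (hint _), integral_cos_succ_mul]
  rw [Finset.sum_range_succ', Finset.sum_eq_zero fun r _ => by rw [integral_cos_succ_mul, add_zero]]
  simp

/-- The characteristic function of the free walk through the levels `i + 1, …, n`. -/
noncomputable def charProd (α : ℕ → ℝ) (i n : ℕ) (θ : ℝ) : ℝ :=
  ∏ l ∈ Finset.Ioc i n, (1 - 2 * α l * (1 - α l) * (1 - Real.cos θ))

@[fun_prop]
lemma continuous_charProd (α : ℕ → ℝ) (i n : ℕ) : Continuous (charProd α i n) := by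
  unfold charProd; fun_prop

/-- The probability that the random walk started at `t` and run through the levels
`n, n - 1, …, i + 1` is not absorbed at `0`, in its Fourier representation. -/
noncomputable def survival (α : ℕ → ℝ) (i n t : ℕ) : ℝ :=
  (1 / Real.pi) * ∫ θ in (0 : ℝ)..Real.pi, charProd α i n θ * harmonic t θ

lemma survival_self (α : ℕ → ℝ) (n t : ℕ) : survival α n n (t + 1) = 1 := by
  simp [survival, charProd, integral_harmonic_succ, Real.pi_ne_zero]

lemma survival_zero (α : ℕ → ℝ) (i n : ℕ) : survival α i n 0 = 0 := by
  simp [survival, harmonic]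

lemma survival_succ (α : ℕ → ℝ) {i n : ℕ} (hi : i ≤ n) (t : ℕ) :
    survival α i (n + 1) (t + 1) =
      (1 - 2 * α (n + 1) * (1 - α (n + 1))) * survival α i n (t + 1)
        + α (n + 1) * (1 - α (n + 1)) * (survival α i n (t + 2) + survival α i n t) := by
  have hint : ∀ (c : ℝ) (s : ℕ), IntervalIntegrable
      (fun θ : ℝ => c * (charProd α i n θ * harmonic s θ))
      MeasureTheory.volume 0 Real.pi := fun c s => by
    apply Continuous.intervalIntegrable; fun_prop
  have hpt : ∀ θ, charProd α i (n + 1) θ * harmonic (t + 1) θ =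
      (1 - 2 * α (n + 1) * (1 - α (n + 1))) * (charProd α i n θ * harmonic (t + 1) θ)
        + α (n + 1) * (1 - α (n + 1)) * (charProd α i n θ * harmonic (t + 2) θ)
        + α (n + 1) * (1 - α (n + 1)) * (charProd α i n θ * harmonic t θ) := by
    intro θ
    have h1 : charProd α i (n + 1) θ = charProd α i n θ *
        (1 - 2 * α (n + 1) * (1 - α (n + 1)) * (1 - Real.cos θ)) := by
      rw [charProd, Finset.prod_Ioc_succ_top hi, charProd]
    have h2 := harmonic_add_two t θ
    rw [h1]
    linear_combination (-(α (n + 1) * (1 - α (n + 1)) * charProd α i n θ)) * h2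
  simp only [survival, hpt]
  rw [integral_add ((hint _ _).add (hint _ _)) (hint _ _), integral_add (hint _ _) (hint _ _)]
  simp only [integral_const_mul]
  ring

/-- The reward earned at level `i` is weighted by the probability of surviving the levels above
`i`. -/
lemma payoff_eq (α ε : ℕ → ℝ) (κ : ℝ) (n t : ℕ) :
    payoff α ε κ n t = κ * survival α 0 n t
      + ∑ i ∈ Finset.Icc 1 n, 2 * α i * ε i * survival α i n t := by
  induction n generalizing t with
  | zero => cases t <;> simp [payoff, survival_zero, survival_self]
  | succ n ih =>
    cases t with
    | zero => simp [payoff, survival_zero]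
    | succ t =>
      rw [payoff, ih, ih, ih, Finset.sum_Icc_succ_top (by omega), survival_self,
        survival_succ α (Nat.zero_le n)]
      have h : ∑ i ∈ Finset.Icc 1 n, 2 * α i * ε i * survival α i (n + 1) (t + 1) =
          ∑ i ∈ Finset.Icc 1 n, 2 * α i * ε i *
            ((1 - 2 * α (n + 1) * (1 - α (n + 1))) * survival α i n (t + 1)
            + α (n + 1) * (1 - α (n + 1)) * (survival α i n (t + 2) + survival α i n t)) :=
        Finset.sum_congr rfl fun i hi => by rw [survival_succ α (Finset.mem_Icc.1 hi).2]
      rw [h]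
      have h' : ∀ a b : ℝ, ∑ i ∈ Finset.Icc 1 n, 2 * α i * ε i *
            (a * survival α i n (t + 1) + b * (survival α i n (t + 2) + survival α i n t)) =
          a * ∑ i ∈ Finset.Icc 1 n, 2 * α i * ε i * survival α i n (t + 1) +
          b * (∑ i ∈ Finset.Icc 1 n, 2 * α i * ε i * survival α i n (t + 2) +
            ∑ i ∈ Finset.Icc 1 n, 2 * α i * ε i * survival α i n t) := by
        intro a b
        rw [← Finset.sum_add_distrib, Finset.mul_sum, Finset.mul_sum, ← Finset.sum_add_distrib]
        exact Finset.sum_congr rfl fun i _ => by ring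
      rw [h']
      ring

/-! ### The Gaussian estimate -/

lemma tau_sub_tau (α : ℕ → ℝ) {i n : ℕ} (hi : i ≤ n) :
    tau α n - tau α i = ∑ k ∈ Finset.Ioc i n, α k * (1 - α k) := by
  rw [sub_eq_iff_eq_add, add_comm]
  exact (Finset.sum_Ioc_consecutive (fun k => α k * (1 - α k)) (Nat.zero_le i) hi).symm

lemma harmonic_one (θ : ℝ) : harmonic 1 θ = 1 + Real.cos θ := by
  simp [harmonic]

section Estimate

variable {α : ℕ → ℝ}

lemma charProd_factor_mem (hα : ∀ n : ℕ, 1 ≤ n → α n ∈ Set.Icc (0 : ℝ) 1) {l : ℕ} (hl : 1 ≤ l)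
    (θ : ℝ) :
    0 ≤ 1 - 2 * α l * (1 - α l) * (1 - Real.cos θ) ∧
      1 - 2 * α l * (1 - α l) * (1 - Real.cos θ) ≤ 1 := by
  obtain ⟨h0, h1⟩ := hα l hl
  have hp : 0 ≤ α l * (1 - α l) := mul_nonneg h0 (sub_nonneg.2 h1)
  have hp' : α l * (1 - α l) ≤ 1 / 4 := by nlinarith [sq_nonneg (α l - 1 / 2)]
  have c0 := Real.neg_one_le_cos θ
  have c1 := Real.cos_le_one θ
  constructor <;> nlinarith

lemma charProd_le_one (hα : ∀ n : ℕ, 1 ≤ n → α n ∈ Set.Icc (0 : ℝ) 1) (i n : ℕ) (θ : ℝ) :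
    charProd α i n θ ≤ 1 := by
  refine Finset.prod_le_one (fun l hl => ?_) (fun l hl => ?_)
  · exact (charProd_factor_mem hα (by have := Finset.mem_Ioc.1 hl; omega) θ).1
  · exact (charProd_factor_mem hα (by have := Finset.mem_Ioc.1 hl; omega) θ).2

lemma charProd_le_exp (hα : ∀ n : ℕ, 1 ≤ n → α n ∈ Set.Icc (0 : ℝ) 1) {i n : ℕ} (hi : i ≤ n)
    (θ : ℝ) :
    charProd α i n θ ≤ Real.exp (-(4 * (tau α n - tau α i)) * Real.sin (θ / 2) ^ 2) := by
  have hsin : 1 - Real.cos θ = 2 * Real.sin (θ / 2) ^ 2 := by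
    have h := Real.cos_two_mul (θ / 2)
    rw [show 2 * (θ / 2) = θ by ring] at h
    have := Real.sin_sq_add_cos_sq (θ / 2)
    linarith
  rw [tau_sub_tau α hi, Finset.mul_sum, ← Finset.sum_neg_distrib, Finset.sum_mul, Real.exp_sum]
  refine Finset.prod_le_prod (fun l hl => ?_) (fun l hl => ?_)
  · exact (charProd_factor_mem hα (by have := Finset.mem_Ioc.1 hl; omega) θ).1
  · refine le_trans (le_of_eq ?_) (Real.add_one_le_exp _)
    rw [hsin]; ring

lemma one_add_cos_le {θ : ℝ} (h0 : 0 ≤ θ) (h1 : θ ≤ Real.pi) :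
    1 + Real.cos θ ≤ 2 * Real.cos (θ / 2) := by
  have h := Real.cos_two_mul (θ / 2)
  rw [show 2 * (θ / 2) = θ by ring] at h
  have c0 : 0 ≤ Real.cos (θ / 2) :=
    Real.cos_nonneg_of_neg_pi_div_two_le_of_le (by linarith) (by linarith)
  have c1 := Real.cos_le_one (θ / 2)
  nlinarith

/-- The substitution `s = sin (θ / 2)` turns the left side into a truncated Gaussian integral. -/
lemma integral_exp_sin_sq_le {y : ℝ} (hy : 0 < y) :
    ∫ θ in (0 : ℝ)..Real.pi, Real.exp (-(4 * y) * Real.sin (θ / 2) ^ 2) * (2 * Real.cos (θ / 2))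
      ≤ Real.sqrt (Real.pi / y) := by
  have hsub : ∫ θ in (0 : ℝ)..Real.pi,
      Real.exp (-(4 * y) * Real.sin (θ / 2) ^ 2) * (Real.cos (θ / 2) * (1 / 2))
      = ∫ s in (0 : ℝ)..1, Real.exp (-(4 * y) * s ^ 2) := by
    have h := integral_comp_mul_deriv (a := 0) (b := Real.pi)
      (f := fun θ => Real.sin (θ / 2)) (f' := fun θ => Real.cos (θ / 2) * (1 / 2))
      (g := fun s => Real.exp (-(4 * y) * s ^ 2))
      (fun θ _ => ((hasDerivAt_id θ).div_const 2).sin) (by fun_prop) (by fun_prop)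
    simpa using h
  have hle : ∫ s in (0 : ℝ)..1, Real.exp (-(4 * y) * s ^ 2)
      ≤ ∫ s in Set.Ioi (0 : ℝ), Real.exp (-(4 * y) * s ^ 2) := by
    rw [integral_of_le zero_le_one]
    refine MeasureTheory.setIntegral_mono_set
      (integrable_exp_neg_mul_sq (by positivity)).integrableOn ?_ ?_
    · exact Filter.Eventually.of_forall fun s => (Real.exp_pos _).le
    · exact Set.Ioc_subset_Ioi_self.eventuallyLE
  rw [integral_gaussian_Ioi] at hle
  have h4 : Real.sqrt (Real.pi / (4 * y)) = Real.sqrt (Real.pi / y) / 2 := by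
    rw [show Real.pi / (4 * y) = Real.pi / y / 2 ^ 2 by field_simp; norm_num,
      Real.sqrt_div (by positivity), Real.sqrt_sq (by norm_num)]
  calc _ = 4 * ∫ θ in (0 : ℝ)..Real.pi,
        Real.exp (-(4 * y) * Real.sin (θ / 2) ^ 2) * (Real.cos (θ / 2) * (1 / 2)) := by
        rw [← integral_const_mul]; congr 1; ext θ; ring
    _ ≤ 4 * (Real.sqrt (Real.pi / (4 * y)) / 2) := by rw [hsub]; linarith
    _ = _ := by rw [h4]; ring

lemma survival_one_le_sigma (hα : ∀ n : ℕ, 1 ≤ n → α n ∈ Set.Icc (0 : ℝ) 1) {i n : ℕ}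
    (hi : i ≤ n) : survival α i n 1 ≤ sigma (tau α n - tau α i) := by
  have hpi := Real.pi_pos
  have hone : survival α i n 1 ≤ 1 := by
    refine le_of_le_of_eq ?_ (survival_self α n 0)
    refine mul_le_mul_of_nonneg_left
      (integral_mono_on hpi.le ?_ ?_ fun θ _ => ?_) (by positivity)
    · apply Continuous.intervalIntegrable; fun_prop
    · apply Continuous.intervalIntegrable; fun_prop
    · have h : 0 ≤ harmonic 1 θ := by
        rw [harmonic_one]; linarith [Real.neg_one_le_cos θ]
      have : charProd α n n θ = 1 := by simp [charProd]
      rw [this]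
      exact mul_le_mul_of_nonneg_right (charProd_le_one hα i n θ) h
  unfold sigma
  split_ifs with hy
  · refine le_min hone ?_
    set y := tau α n - tau α i
    have hint : ∫ θ in (0 : ℝ)..Real.pi, charProd α i n θ * harmonic 1 θ
        ≤ Real.sqrt (Real.pi / y) := by
      refine le_trans (integral_mono_on hpi.le ?_ ?_ fun θ hθ => ?_) (integral_exp_sin_sq_le hy)
      · apply Continuous.intervalIntegrable; fun_prop
      · apply Continuous.intervalIntegrable; fun_prop
      · rw [harmonic_one]
        exact mul_le_mul (charProd_le_exp hα hi θ) (one_add_cos_le hθ.1 hθ.2)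
          (by linarith [Real.neg_one_le_cos θ]) (Real.exp_pos _).le
    have hs : (1 / Real.pi) * Real.sqrt (Real.pi / y) = 1 / Real.sqrt (Real.pi * y) := by
      rw [Real.sqrt_div hpi.le, Real.sqrt_mul hpi.le]
      have h1 : Real.sqrt Real.pi ≠ 0 := (Real.sqrt_pos.2 hpi).ne'
      have h2 : Real.sqrt y ≠ 0 := (Real.sqrt_pos.2 hy).ne'
      have h3 := Real.mul_self_sqrt hpi.le
      field_simp
      nlinarith
    rw [survival, ← hs]
    gcongr
  · exact hone

end Estimate

/-! ### Convergence -/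

lemma sigma_nonneg (y : ℝ) : 0 ≤ sigma y := by
  unfold sigma; split_ifs <;> positivity

lemma sigma_le_one (y : ℝ) : sigma y ≤ 1 := by
  unfold sigma; split_ifs <;> simp

lemma tendsto_sigma : Tendsto sigma atTop (𝓝 0) := by
  have h : Tendsto (fun y : ℝ => 1 / Real.sqrt (Real.pi * y)) atTop (𝓝 0) := by
    simp only [one_div]
    exact (Real.tendsto_sqrt_atTop.comp
      (tendsto_id.const_mul_atTop Real.pi_pos)).inv_tendsto_atTop
  refine squeeze_zero' (Eventually.of_forall sigma_nonneg) ?_ h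
  filter_upwards [eventually_gt_atTop 0] with y hy
  rw [sigma, if_pos hy]
  exact min_le_right _ _

/-- The accumulated errors vanish in the limit, by dominated convergence for series. -/
lemma tendsto_error_sum {α ε : ℕ → ℝ} (hnn : ∀ i, 0 ≤ α (i + 1) * ε (i + 1))
    (hτ : Tendsto (tau α) atTop atTop) (hs : Summable fun k : ℕ => α (k + 1) * ε (k + 1)) :
    Tendsto (fun n => ∑ i ∈ Finset.Icc 1 n, 2 * α i * ε i * sigma (tau α n - tau α i))
      atTop (𝓝 0) := by
  have h := tendsto_tsum_of_dominated_convergence (𝓕 := atTop)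
    (f := fun n i => if i < n then
      2 * α (i + 1) * ε (i + 1) * sigma (tau α n - tau α (i + 1)) else 0)
    (g := fun _ => (0 : ℝ)) (bound := fun i => 2 * (α (i + 1) * ε (i + 1)))
    (hs.mul_left 2) (fun i => ?_) (Eventually.of_forall fun n i => ?_)
  · rw [tsum_zero] at h
    refine h.congr fun n => ?_
    rw [tsum_eq_sum (s := Finset.range n) fun i hi => if_neg (by simpa using hi),
      Finset.range_eq_Ico, Finset.sum_congr rfl fun i hi => if_pos (Finset.mem_Ico.1 hi).2,
      Finset.sum_Ico_add' (fun i => 2 * α i * ε i * sigma (tau α n - tau α i)) 0 n 1]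
    rfl
  · have h1 : Tendsto (fun n => sigma (tau α n - tau α (i + 1))) atTop (𝓝 0) :=
      tendsto_sigma.comp (tendsto_atTop_add_const_right _ _ hτ)
    have h2 := h1.const_mul (2 * α (i + 1) * ε (i + 1))
    rw [mul_zero] at h2
    refine h2.congr' ?_
    filter_upwards [eventually_gt_atTop i] with n hn
    rw [if_pos hn]
  · have := hnn i
    split_ifs
    · rw [mul_assoc 2, Real.norm_of_nonneg (mul_nonneg (by positivity) (sigma_nonneg _))]
      exact mul_le_of_le_one_right (by positivity) (sigma_le_one _)
    · rw [norm_zero]; positivity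

end InexactKM

theorem theorem1 {X : Type*} [NormedAddCommGroup X] [NormedSpace ℝ X]
    (C : Set X) (hC_closed : IsClosed C) (hC_convex : Convex ℝ C)
    (T : X → X) (hT_maps : Set.MapsTo T C C) (hT : LipschitzOnWith 1 T C)
    (α : ℕ → ℝ) (hα : ∀ n : ℕ, 1 ≤ n → α n ∈ Set.Icc (0 : ℝ) 1)
    (e : ℕ → X) (ε : ℕ → ℝ) (hε : ∀ n : ℕ, 1 ≤ n → ‖e n‖ ≤ ε n)
    (x : ℕ → X) (hx : InexactKM.IsIteration T α e x)
    (κ : ℝ) (hκ : 0 ≤ κ) (hxC : ∀ n : ℕ, x n ∈ C) (hTx : ∀ n : ℕ, ‖T (x n) - x 0‖ ≤ κ) :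
    (∀ n : ℕ, ‖x n - T (x n)‖ ≤
        κ * InexactKM.sigma (InexactKM.tau α n)
          + ∑ i ∈ Finset.Icc 1 n,
              2 * α i * ε i * InexactKM.sigma (InexactKM.tau α n - InexactKM.tau α i)
          + 2 * ε (n + 1)) ∧
    (Tendsto (InexactKM.tau α) atTop atTop → Tendsto ε atTop (𝓝 0) →
      Summable (fun k : ℕ => α (k + 1) * ε (k + 1)) →
      Tendsto (fun n : ℕ => ‖x n - T (x n)‖) atTop (𝓝 0)) := by
  have bound : ∀ n : ℕ, ‖x n - T (x n)‖ ≤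
      κ * InexactKM.sigma (InexactKM.tau α n)
        + ∑ i ∈ Finset.Icc 1 n,
            2 * α i * ε i * InexactKM.sigma (InexactKM.tau α n - InexactKM.tau α i)
        + 2 * ε (n + 1) := by
    intro n
    have h := (InexactKM.norm_sub_le_coinAvg hT hx hα hε hxC hTx n).1 0
    simp only [add_zero, InexactKM.coinAvg, Finset.range_zero, Finset.sum_empty] at h
    rw [InexactKM.payoff_eq] at h
    have h0 := InexactKM.survival_one_le_sigma hα (Nat.zero_le n)
    rw [show InexactKM.tau α 0 = 0 by simp [InexactKM.tau], sub_zero] at h0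
    have hε0 : 0 ≤ ε (n + 1) := (norm_nonneg _).trans (hε _ (by omega))
    refine h.trans ((add_le_add (mul_le_mul_of_nonneg_left h0 hκ)
      (Finset.sum_le_sum fun i hi => ?_)).trans (le_add_of_nonneg_right (by positivity)))
    obtain ⟨hi1, hin⟩ := Finset.mem_Icc.1 hi
    have hα0 := (hα i hi1).1
    have hεi : 0 ≤ ε i := (norm_nonneg _).trans (hε i hi1)
    exact mul_le_mul_of_nonneg_left (InexactKM.survival_one_le_sigma hα hin) (by positivity)
  refine ⟨bound, fun hτ hε0 hs => ?_⟩
  have h1 := (InexactKM.tendsto_sigma.comp hτ).const_mul κ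
  have h2 := InexactKM.tendsto_error_sum (fun i => mul_nonneg (hα _ (by omega)).1
    ((norm_nonneg _).trans (hε _ (by omega)))) hτ hs
  have h3 := (hε0.comp (tendsto_add_atTop_nat 1)).const_mul 2
  have h := (h1.add h2).add h3
  rw [mul_zero, mul_zero, add_zero, add_zero] at h
  exact squeeze_zero (fun n => norm_nonneg _) bound h
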